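/- Let $G$ be a finite undirected graph without loops, let $\mathrm{maxval}(G)$ be its maximal vertex degree (read as $0$ if $G$ has no vertices), let $n\ge 0$ be an integer, and set $\mathrm{vgap}(G,n):=n-\mathrm{maxval}(G)-1\in\mathbb Z$. Let $K_n$ be the complete loopless graph on $n$ vertices. For finite loopless graphs $G,H$, let $\mathrm{Hom}(G,H)$ be the polyhedral complex whose cells are indexed by the functions $\eta:V(G)\to 2^{V(H)}\setminus\{\varnothing\}$ such that $(x,y)\in E(G)$ implies $\eta(x)\times\eta(y)\subseteq E(H)$; the cell $\eta$ is the product over $v \in V(G)$ of the simplices with vertex sets $\eta(v)$, it has dimension $\sum_{v}|\eta(v)|-|V(G)|$, and its closure consists of the cells $\tilde\eta$ with $\tilde\eta(v)\subseteq\eta(v)$ for all $v$. Its homology $H_t(\mathrm{Hom}(G,H);\mathbb Z)$ is the homology of its cellular chain complex: for linear orders on $V(G)$ and $V(H)$, and the corresponding orientation of the cells, the boundary operator is $$\partial\eta=\sum_{v\in V(G)}\ \sum_{\substack{x\in\eta(v)\\ |\eta(v)|\ge 2}}(-1)^{c(v,x)}\,\eta_{v,x},\qquad c(v,x)=\sum_{u<v}|\eta(u)|+|\{y\in\eta(v):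 y<x\}|,$$ where $\eta_{v,x}$ is obtained from $\eta$ by replacing $\eta(v)$ by $\eta(v)\setminus\{x\}$. Then $$H_t(\mathrm{Hom}(G,K_n);\mathbb Z)=0\qquad\text{for all integers } t \text{ with } 1\le t\le \mathrm{vgap}(G,n)-1 .$$ -/

import Mathlib

open CategoryTheory

noncomputable section

/-- `G.maxDegree` is the maximal valency of `G` (and `0` if `G` has no vertices).  The
`n`-color-valency gap `n - maxval G - 1` is an integer, possibly negative. -/
def vgap {V : Type*} [Fintype V] (G : SimpleGraph V) [DecidableRel G.Adj] (n : ℕ) : ℤ :=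
  (n : ℤ) - (G.maxDegree : ℤ) - 1

/-- The condition on a function `η : V(G) → 2 ^ V(H)` to index a cell of `Hom(G, H)`: all values
are nonempty, and `η x × η y ⊆ E(H)` whenever `(x, y) ∈ E(G)`. -/
def IsHomCell {V W : Type*} (G : SimpleGraph V) (H : SimpleGraph W) (η : V → Finset W) : Prop :=
  (∀ v, (η v).Nonempty) ∧ ∀ x y, G.Adj x y → ∀ a ∈ η x, ∀ b ∈ η y, H.Adj a b

/-- The `t`-dimensional cells of the polyhedral complex `Hom(G, H)`.  The cell `η` is the product
over `v` of the simplices with vertex set `η v`, so that its dimension is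
`∑ v, |η v| - |V(G)|`. -/
structure HomCell {V W : Type*} [Fintype V] (G : SimpleGraph V) (H : SimpleGraph W)
    (t : ℕ) where
  /-- the list of colors allowed at each vertex of `G` -/
  toFun : V → Finset W
  isHomCell : IsHomCell G H toFun
  dim_eq : ∑ v, (toFun v).card = t + Fintype.card V

namespace HomCell

variable {V W : Type*} [Fintype V] {G : SimpleGraph V} {H : SimpleGraph W} {t : ℕ}

theorem ext_toFun {η ξ : HomCell G H t} (h : η.toFun = ξ.toFun) : η = ξ := by
  cases η; cases ξ; cases h; rfl

/-- The index set of the codimension one faces of a cell `η`: pairs `(v, x)` with `x ∈ η v` and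
`|η v| ≥ 2`. -/
abbrev Removable (η : HomCell G H t) : Type _ :=
  {p : V × W // p.2 ∈ η.toFun p.1 ∧ 2 ≤ (η.toFun p.1).card}

variable [LinearOrder V] [LinearOrder W]

/-- The codimension one face of `η` obtained by deleting the color `x` from the list `η v`. -/
def face (η : HomCell G H (t + 1)) (p : η.Removable) : HomCell G H t where
  toFun := Function.update η.toFun p.1.1 ((η.toFun p.1.1).erase p.1.2)
  isHomCell := by
    have hsub : ∀ v, Function.update η.toFun p.1.1 ((η.toFun p.1.1).erase p.1.2) v
        ⊆ η.toFun v := by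
      intro v
      by_cases hv : v = p.1.1
      · subst hv
        simpa using Finset.erase_subset _ _
      · simp [Function.update_of_ne hv]
    refine ⟨fun v => ?_, fun x y hxy a ha b hb =>
      η.isHomCell.2 x y hxy a (hsub x ha) b (hsub y hb)⟩
    by_cases hv : v = p.1.1
    · subst hv
      rw [Function.update_self, ← Finset.card_pos, Finset.card_erase_of_mem p.2.1]
      have := p.2.2
      omega
    · rw [Function.update_of_ne hv]
      exact η.isHomCell.1 v
  dim_eq := by
    have h := η.dim_eq
    have h2 := p.2.2
    rw [← Finset.add_sum_erase _ _ (Finset.mem_univ p.1.1)] at h ⊢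
    rw [Function.update_self, Finset.card_erase_of_mem p.2.1]
    have : ∑ v ∈ Finset.univ.erase p.1.1,
        (Function.update η.toFun p.1.1 ((η.toFun p.1.1).erase p.1.2) v).card
        = ∑ v ∈ Finset.univ.erase p.1.1, (η.toFun v).card :=
      Finset.sum_congr rfl fun v hv => by
        rw [Function.update_of_ne (Finset.ne_of_mem_erase hv)]
    rw [this]
    omega

/-- The exponent of the incidence number of `η` and its face at `(v, x)`:
`c(x) = ∑_{u < v} |η u| + |{y ∈ η v : y < x}|`. -/
def signExp (η : V → Finset W) (v : V) (x : W) : ℕ :=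
  ∑ u with u < v, (η u).card + ((η v).filter (· < x)).card

theorem sign_cancel (η : V → Finset W) {v w : V} {x y : W} (hx : x ∈ η v)
    (hy : y ∈ η w) (hlt : v < w ∨ v = w ∧ x < y) :
    (-1 : ℤ) ^ signExp η v x * (-1) ^ signExp (Function.update η v ((η v).erase x)) w y
      + (-1) ^ signExp η w y * (-1) ^ signExp (Function.update η w ((η w).erase y)) v x = 0 := by
  have h1 : signExp (Function.update η w ((η w).erase y)) v x = signExp η v x := by
    unfold signExp
    have hs : ∑ u with u < v, (Function.update η w ((η w).erase y) u).card
        = ∑ u with u < v, (η u).card := by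
      refine Finset.sum_congr rfl fun u hu => ?_
      have : u < v := by simpa using hu
      have : u ≠ w := by
        rcases hlt with h | ⟨h, -⟩
        · exact (this.trans h).ne
        · exact (h ▸ this).ne
      rw [Function.update_of_ne this]
    rw [hs]
    congr 1
    rcases hlt with h | ⟨rfl, h⟩
    · rw [Function.update_of_ne h.ne]
    · rw [Function.update_self]
      congr 1
      ext z
      simp only [Finset.mem_filter, Finset.mem_erase]
      constructor
      · tauto
      · rintro ⟨hz, hzx⟩
        exact ⟨⟨(hzx.trans h).ne, hz⟩, hzx⟩
  have h2 : signExp (Function.update η v ((η v).erase x)) w y + 1 = signExp η w y := by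
    unfold signExp
    rcases hlt with h | ⟨rfl, h⟩
    · rw [Function.update_of_ne h.ne']
      have hv : v ∈ Finset.univ.filter (· < w) := by simpa using h
      rw [← Finset.add_sum_erase _ _ hv, ← Finset.add_sum_erase _ (fun u => (η u).card) hv,
        Function.update_self, Finset.card_erase_of_mem hx]
      have hs : ∑ u ∈ (Finset.univ.filter (· < w)).erase v,
          (Function.update η v ((η v).erase x) u).card
          = ∑ u ∈ (Finset.univ.filter (· < w)).erase v, (η u).card :=
        Finset.sum_congr rfl fun u hu => by
          rw [Function.update_of_ne (Finset.ne_of_mem_erase hu)]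
      have := Finset.card_pos.2 ⟨x, hx⟩
      rw [hs]
      omega
    · have hs : ∑ u with u < v, (Function.update η v ((η v).erase x) u).card
          = ∑ u with u < v, (η u).card := by
        refine Finset.sum_congr rfl fun u hu => ?_
        have : u < v := by simpa using hu
        rw [Function.update_of_ne this.ne]
      have hx' : x ∈ (η v).filter (· < y) := by simp [hx, h]
      rw [hs, Function.update_self, Finset.filter_erase, Finset.card_erase_of_mem hx']
      have := Finset.card_pos.2 ⟨x, hx'⟩
      omega
  rw [h1, ← h2]
  ring

end HomCell

section Chains

variable {V W : Type*} [Fintype V] [Fintype W] [LinearOrder V] [LinearOrder W]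
  (G : SimpleGraph V) (H : SimpleGraph W)

/-- The cellular boundary operator of `Hom(G, H)`, for the orientation of the cells given by linear
orders of `V(G)` and `V(H)`: `∂ η = ∑ (-1) ^ c(x) • (η with x deleted from η v)`, the sum running
over all `v` and all `x ∈ η v` such that `|η v| ≥ 2`. -/
def homBoundary (t : ℕ) : (HomCell G H (t + 1) →₀ ℤ) →ₗ[ℤ] (HomCell G H t →₀ ℤ) :=
  Finsupp.linearCombination ℤ fun η : HomCell G H (t + 1) =>
    ∑ p : η.Removable,
      Finsupp.single (η.face p) ((-1 : ℤ) ^ HomCell.signExp η.toFun p.1.1 p.1.2)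

theorem homBoundary_comp (t : ℕ) :
    homBoundary G H t ∘ₗ homBoundary G H (t + 1) = 0 := by
  refine Finsupp.lhom_ext' fun η => LinearMap.ext_ring ?_
  simp only [LinearMap.comp_apply, Finsupp.lsingle_apply, LinearMap.zero_apply, homBoundary,
    Finsupp.linearCombination_single, one_smul, map_sum, Finset.smul_sum, Finsupp.smul_single,
    smul_eq_mul]
  rw [Finset.sum_sigma']
  have key : ∀ a : (Σ p : η.Removable, (η.face p).Removable),
      a.2.1.2 ∈ η.toFun a.2.1.1 ∧ 2 ≤ (η.toFun a.2.1.1).card ∧ a.2.1 ≠ a.1.1 := by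
    rintro ⟨⟨⟨v, x⟩, hp⟩, ⟨⟨w, y⟩, hq⟩⟩
    simp only [HomCell.face] at hq
    simp only at hp ⊢
    by_cases hw : w = v
    · subst hw
      simp only [Function.update_self, Finset.mem_erase] at hq
      exact ⟨hq.1.2, hp.2, fun h => hq.1.1 (Prod.mk.inj h).2⟩
    · simp only [Function.update_of_ne hw] at hq
      exact ⟨hq.1, hq.2, fun h => hw (Prod.mk.inj h).1⟩
  have key2 : ∀ a : (Σ p : η.Removable, (η.face p).Removable),
      a.1.1.2 ∈ (η.face ⟨a.2.1, (key a).1, (key a).2.1⟩).toFun a.1.1.1 ∧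
      2 ≤ ((η.face ⟨a.2.1, (key a).1, (key a).2.1⟩).toFun a.1.1.1).card := by
    intro a
    obtain ⟨k1, k2, k3⟩ := key a
    obtain ⟨⟨⟨v, x⟩, hp⟩, ⟨⟨w, y⟩, hq⟩⟩ := a
    simp only [HomCell.face] at *
    by_cases hw : v = w
    · subst hw
      simp only [Function.update_self] at *
      have hxy : x ≠ y := fun h => k3 (by rw [h])
      refine ⟨Finset.mem_erase.2 ⟨hxy, hp.1⟩, ?_⟩
      rw [Finset.card_erase_of_mem k1]
      have h2 : 2 ≤ ((η.toFun v).erase x).card := by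
        simpa only [HomCell.face, Function.update_self] using hq.2
      rwa [Finset.card_erase_of_mem hp.1] at h2
    · simp only [Function.update_of_ne hw]
      exact hp
  refine Finset.sum_involution
    (fun a _ => ⟨⟨a.2.1, (key a).1, (key a).2.1⟩, ⟨a.1.1, key2 a⟩⟩) ?_ ?_ ?_ ?_
  · intro a _
    obtain ⟨k1, k2, k3⟩ := key a
    have hface : (η.face a.1).face a.2
        = (η.face ⟨a.2.1, k1, k2⟩).face ⟨a.1.1, key2 a⟩ := by
      apply HomCell.ext_toFun
      obtain ⟨⟨⟨v, x⟩, hp⟩, ⟨⟨w, y⟩, hq⟩⟩ := a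
      simp only [HomCell.face]
      by_cases hw : v = w
      · subst hw
        simp [Finset.erase_right_comm]
      · rw [Function.update_of_ne (Ne.symm hw), Function.update_of_ne hw,
          Function.update_comm hw]
    rw [← hface, ← Finsupp.single_add]
    refine Finsupp.single_eq_zero.2 ?_
    obtain ⟨⟨⟨v, x⟩, hp⟩, ⟨⟨w, y⟩, hq⟩⟩ := a
    simp only [HomCell.face] at *
    rcases lt_trichotomy v w with h | h | h
    · exact HomCell.sign_cancel η.toFun hp.1 k1 (Or.inl h)
    · subst h
      rcases lt_trichotomy x y with h' | h' | h'
      · exact HomCell.sign_cancel η.toFun hp.1 k1 (Or.inr ⟨rfl, h'⟩)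
      · exact absurd (congrArg (Prod.mk v) h'.symm) k3
      · rw [add_comm]
        exact HomCell.sign_cancel η.toFun k1 hp.1 (Or.inr ⟨rfl, h'⟩)
    · rw [add_comm]
      exact HomCell.sign_cancel η.toFun k1 hp.1 (Or.inl h)
  · intro a _ _ h
    exact (key a).2.2 (congrArg (fun b => b.1.1) h)
  · intro a _
    exact Finset.mem_univ _
  · intro a _
    rfl

/-- The cellular chain complex of `Hom(G, H)` with integer coefficients: in degree `t` the free
abelian group on the `t`-dimensional cells. -/
def homChainComplex : ChainComplex (ModuleCat ℤ) ℕ :=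
  ChainComplex.of (fun t => ModuleCat.of ℤ (HomCell G H t →₀ ℤ))
    (fun t => ModuleCat.ofHom (homBoundary G H t)) fun t => by
      rw [← ModuleCat.ofHom_comp, homBoundary_comp]
      rfl

/-- The homology group `H_t(Hom(G, H); ℤ)` of the polyhedral complex `Hom(G, H)`. -/
def homHomology (t : ℕ) : ModuleCat ℤ :=
  (homChainComplex G H).homology t

end Chains

end

set_option linter.unusedSectionVars false

noncomputable section

/-! The vertices of `G` are added in increasing order. For the cells living on a vertex set `U`,
every cycle of degree `t ≠ 0` with `t + G.maxDegree + 2 ≤ n` is shown to bound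
(`exists_boundary_eq`).

Let `v` be the new, largest vertex. Forgetting its colors is a chain map (`proj_boundary`), so the
projection of a cycle `z` is a cycle, which bounds some `y` by induction. The cells of `y` have
dimension `t + 1`, so at most `t + 1 + deg v < n` colors occur at the neighbors of `v`
(`card_usedColors_le`) and some color is free for `v`. This lifts `y`, and subtracting the boundary
of the lift from `z` leaves a cycle killed by `proj v`.

Over a fixed cell on the other vertices, the set at `v` ranges over the faces of a simplex, spanned
by the colors unused at the neighbors. Coning with a chosen color contracts it. The choice varies
with the cell, so the homotopy formula holds only modulo cells with fewer colors off `v`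
(`homotopy_mem_supported`). Induction on that number shows that the remaining cycle bounds
(`exists_boundary_eq_of_proj_eq_zero`). -/

namespace HomCell

variable {V W : Type*} [Fintype V] [Fintype W] [LinearOrder V] [LinearOrder W]

/-! ### Chains of set families and their boundary -/

/-- The set family `η` with the color `p.2` deleted from `η p.1`. -/
def delete (η : V → Finset W) (p : V × W) : V → Finset W :=
  Function.update η p.1 ((η p.1).erase p.2)

/-- The pairs `(v, x)` with `x ∈ η v` and `|η v| ≥ 2`. -/
def removable (η : V → Finset W) : Finset (V × W) :=
  Finset.univ.filter fun p => p.2 ∈ η p.1 ∧ 2 ≤ (η p.1).card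

theorem mem_removable {η : V → Finset W} {p : V × W} :
    p ∈ removable η ↔ p.2 ∈ η p.1 ∧ 2 ≤ (η p.1).card := by
  simp [removable]

/-- The incidence number of `η` and its face at `p`. -/
def sign (η : V → Finset W) (p : V × W) : ℤ := (-1) ^ signExp η p.1 p.2

theorem sign_mul_self (η : V → Finset W) (p : V × W) : sign η p * sign η p = 1 := by
  unfold sign
  rw [← mul_pow]
  simp

/-- This makes swapping two successive deletions a fixed-point-free involution, which pairs off the
terms of the squared boundary. -/
theorem removable_delete {η : V → Finset W} {p q : V × W} (hp : p ∈ removable η)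
    (hq : q ∈ removable (delete η p)) :
    q ∈ removable η ∧ p ∈ removable (delete η q) ∧ p ≠ q := by
  obtain ⟨v, x⟩ := p
  obtain ⟨w, y⟩ := q
  simp only [mem_removable, delete] at *
  by_cases h : w = v
  · subst h
    simp only [Function.update_self, Finset.mem_erase] at *
    rw [Finset.card_erase_of_mem hp.1] at hq
    rw [Finset.card_erase_of_mem hq.1.2]
    refine ⟨⟨hq.1.2, hp.2⟩, ⟨⟨Ne.symm hq.1.1, hp.1⟩, hq.2⟩, fun h => hq.1.1 (Prod.mk.inj h).2.symm⟩
  · rw [Function.update_of_ne h] at hq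
    rw [Function.update_of_ne (Ne.symm h)]
    exact ⟨hq, hp, fun h' => h (Prod.mk.inj h').1.symm⟩

theorem delete_comm (η : V → Finset W) (p q : V × W) :
    delete (delete η p) q = delete (delete η q) p := by
  obtain ⟨v, x⟩ := p
  obtain ⟨w, y⟩ := q
  simp only [delete]
  by_cases h : v = w
  · subst h
    simp [Finset.erase_right_comm]
  · rw [Function.update_of_ne (Ne.symm h), Function.update_of_ne h, Function.update_comm h]

theorem sign_mul_sign_delete {η : V → Finset W} {p q : V × W} (hp : p.2 ∈ η p.1)
    (hq : q.2 ∈ η q.1) (hne : p ≠ q) :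
    sign η p * sign (delete η p) q + sign η q * sign (delete η q) p = 0 := by
  obtain ⟨v, x⟩ := p
  obtain ⟨w, y⟩ := q
  unfold sign delete
  rcases lt_trichotomy v w with h | h | h
  · exact sign_cancel η hp hq (Or.inl h)
  · subst h
    rcases lt_trichotomy x y with h' | h' | h'
    · exact sign_cancel η hp hq (Or.inr ⟨rfl, h'⟩)
    · exact absurd (congrArg (Prod.mk v) h') hne
    · rw [add_comm]
      exact sign_cancel η hq hp (Or.inr ⟨rfl, h'⟩)
  · rw [add_comm]
    exact sign_cancel η hq hp (Or.inl h)

/-- The cellular boundary operator on the free abelian group on all set families; empty sets of a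
family are left untouched. -/
def boundary : ((V → Finset W) →₀ ℤ) →ₗ[ℤ] ((V → Finset W) →₀ ℤ) :=
  Finsupp.linearCombination ℤ fun η =>
    ∑ p ∈ removable η, Finsupp.single (delete η p) (sign η p)

theorem boundary_single (η : V → Finset W) (a : ℤ) :
    boundary (Finsupp.single η a) =
      a • ∑ p ∈ removable η, Finsupp.single (delete η p) (sign η p) := by
  simp [boundary]

theorem boundary_boundary (z : (V → Finset W) →₀ ℤ) : boundary (boundary z) = 0 := by
  suffices h : (boundary ∘ₗ boundary : ((V → Finset W) →₀ ℤ) →ₗ[ℤ] _) = 0 from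
    LinearMap.congr_fun h z
  refine Finsupp.lhom_ext' fun η => LinearMap.ext_ring ?_
  simp only [LinearMap.comp_apply, Finsupp.lsingle_apply, LinearMap.zero_apply, boundary_single,
    one_smul, map_sum, Finset.smul_sum, Finsupp.smul_single, smul_eq_mul]
  rw [Finset.sum_sigma']
  refine Finset.sum_involution (fun a _ => ⟨a.2, a.1⟩) ?_ ?_ ?_ ?_
  · rintro ⟨p, q⟩ h
    rw [Finset.mem_sigma] at h
    obtain ⟨h1, h2, h3⟩ := removable_delete h.1 h.2
    simp only
    rw [delete_comm η q p, ← Finsupp.single_add,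
      sign_mul_sign_delete (mem_removable.1 h.1).1 (mem_removable.1 h1).1 h3, Finsupp.single_zero]
  · rintro ⟨p, q⟩ h _ h'
    rw [Finset.mem_sigma] at h
    exact (removable_delete h.1 h.2).2.2 (congrArg Sigma.fst h').symm
  · rintro ⟨p, q⟩ h
    rw [Finset.mem_sigma] at h ⊢
    exact ⟨(removable_delete h.1 h.2).1, (removable_delete h.1 h.2).2.1⟩
  · intro a _
    rfl

/-- The sum of the faces of `η` in direction `v`. -/
def boundaryAt (v : V) (η : V → Finset W) : (V → Finset W) →₀ ℤ :=
  ∑ x ∈ η v with 2 ≤ (η v).card, Finsupp.single (delete η (v, x)) (sign η (v, x))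

theorem boundary_single_one (η : V → Finset W) :
    boundary (Finsupp.single η 1) = ∑ v, boundaryAt v η := by
  rw [boundary_single, one_smul]
  exact Finset.sum_finset_product _ _ _ fun p => by
    simp only [mem_removable, Finset.mem_univ, true_and, Finset.mem_filter]

/-- The families that are nonempty exactly on `U`, with disjoint values at adjacent vertices, and of
dimension `t`: the `t`-cells of the complex of colorings of the subgraph induced on `U`. -/
def cells (G : SimpleGraph V) (U : Finset V) (t : ℕ) : Set (V → Finset W) :=
  {η | (∀ u, (η u).Nonempty ↔ u ∈ U) ∧ (∀ x y, G.Adj x y → Disjoint (η x) (η y)) ∧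
    ∑ u, (η u).card = t + U.card}

theorem sum_card_update (η : V → Finset W) (v : V) (s : Finset W) :
    ∑ u, (Function.update η v s u).card + (η v).card = ∑ u, (η u).card + s.card := by
  rw [← Finset.add_sum_erase _ _ (Finset.mem_univ v),
    ← Finset.add_sum_erase _ (fun u => (η u).card) (Finset.mem_univ v), Function.update_self,
    Finset.sum_congr rfl fun u hu => by rw [Function.update_of_ne (Finset.ne_of_mem_erase hu)]]
  ring

theorem disjoint_update {G : SimpleGraph V} {η : V → Finset W} {v : V} {s : Finset W}
    (h : ∀ x y, G.Adj x y → Disjoint (η x) (η y)) (hs : ∀ u, G.Adj v u → Disjoint s (η u))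
    (x y : V) (hxy : G.Adj x y) :
    Disjoint (Function.update η v s x) (Function.update η v s y) := by
  by_cases hx : x = v
  · subst hx
    rw [Function.update_self, Function.update_of_ne hxy.ne']
    exact hs y hxy
  · rw [Function.update_of_ne hx]
    by_cases hy : y = v
    · subst hy
      rw [Function.update_self]
      exact (hs x hxy.symm).symm
    · rw [Function.update_of_ne hy]
      exact h x y hxy

theorem delete_mem_cells {G : SimpleGraph V} {U : Finset V} {t : ℕ} {η : V → Finset W}
    (hη : η ∈ cells G U (t + 1)) {p : V × W} (hp : p ∈ removable η) : delete η p ∈ cells G U t := by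
  obtain ⟨h1, h2, h3⟩ := hη
  rw [mem_removable] at hp
  have hc := Finset.card_erase_of_mem hp.1
  refine ⟨fun u => ?_, disjoint_update h2 fun u hu => ?_, ?_⟩
  · rw [← h1]
    by_cases hu : u = p.1
    · subst hu
      rw [delete, Function.update_self, ← Finset.card_pos, ← Finset.card_pos]
      omega
    · rw [delete, Function.update_of_ne hu]
  · exact (h2 _ _ hu).mono_left (Finset.erase_subset _ _)
  · have := sum_card_update η p.1 ((η p.1).erase p.2)
    unfold delete
    omega

theorem boundary_mem_supported {G : SimpleGraph V} {U : Finset V} {t : ℕ}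
    {z : (V → Finset W) →₀ ℤ} (hz : z ∈ Finsupp.supported ℤ ℤ (cells G U (t + 1))) :
    boundary z ∈ Finsupp.supported ℤ ℤ (cells G U t) := by
  rw [boundary, Finsupp.linearCombination_apply]
  refine Submodule.sum_mem _ fun η hη => Submodule.smul_mem _ _ <| Submodule.sum_mem _ fun p hp =>
    Finsupp.single_mem_supported _ _ (delete_mem_cells (hz hη) hp)

theorem sign_congr {η ξ : V → Finset W} {v : V} {x y : W} (h : ∀ u < v, η u = ξ u)
    (hxy : ((η v).filter (· < x)).card = ((ξ v).filter (· < y)).card) :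
    sign η (v, x) = sign ξ (v, y) := by
  unfold sign signExp
  simp only [hxy]
  rw [Finset.sum_congr rfl fun u hu => by rw [h u (by simpa using hu)]]

theorem delete_update_of_ne (η : V → Finset W) {u v : V} (h : u ≠ v) (x : W) (s : Finset W) :
    delete (Function.update η v s) (u, x) = Function.update (delete η (u, x)) v s := by
  simp only [delete, Function.update_of_ne h]
  rw [Function.update_comm h]

theorem delete_apply_of_ne (η : V → Finset W) {u v : V} (h : u ≠ v) (x : W) :
    delete η (u, x) v = η v :=
  Function.update_of_ne h.symm _ _

theorem update_delete_self (η : V → Finset W) (v : V) (x : W) (s : Finset W) :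
    Function.update (delete η (v, x)) v s = Function.update η v s :=
  Function.update_idem _ _ _

/-! ### Forgetting, choosing and adding a color at one vertex -/

/-- The projection forgetting the colors of `v`; a cell with at least two colors at `v` is sent
to `0`. -/
def proj (v : V) : ((V → Finset W) →₀ ℤ) →ₗ[ℤ] ((V → Finset W) →₀ ℤ) :=
  Finsupp.linearCombination ℤ fun η =>
    if (η v).card = 1 then Finsupp.single (Function.update η v ∅) 1 else 0

/-- The section of `proj v` that gives `v` the single color `col η`. -/
def lift (v : V) (col : (V → Finset W) → W) :
    ((V → Finset W) →₀ ℤ) →ₗ[ℤ] ((V → Finset W) →₀ ℤ) :=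
  Finsupp.linearCombination ℤ fun η => Finsupp.single (Function.update η v {col η}) 1

/-- The cone operator adding the color `col η` at `v`. -/
def cone (v : V) (col : (V → Finset W) → W) :
    ((V → Finset W) →₀ ℤ) →ₗ[ℤ] ((V → Finset W) →₀ ℤ) :=
  Finsupp.linearCombination ℤ fun η =>
    if col η ∈ η v then 0
    else Finsupp.single (Function.update η v (insert (col η) (η v))) (sign η (v, col η))

theorem proj_single (v : V) (η : V → Finset W) (a : ℤ) :
    proj v (Finsupp.single η a) =
      if (η v).card = 1 then Finsupp.single (Function.update η v ∅) a else 0 := by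
  simp [proj]

theorem lift_single (v : V) (col : (V → Finset W) → W) (η : V → Finset W) (a : ℤ) :
    lift v col (Finsupp.single η a) = Finsupp.single (Function.update η v {col η}) a := by
  simp [lift]

theorem cone_single (v : V) (col : (V → Finset W) → W) (η : V → Finset W) (a : ℤ) :
    cone v col (Finsupp.single η a) = if col η ∈ η v then 0
      else Finsupp.single (Function.update η v (insert (col η) (η v)))
        (a * sign η (v, col η)) := by
  simp [cone]

/-- A deletion leaves a single color only if `|η v| = 2`. The two faces then project to the same
cell, with opposite signs. -/
theorem proj_boundaryAt_self (v : V) (η : V → Finset W) : proj v (boundaryAt v η) = 0 := by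
  simp only [boundaryAt, map_sum, proj_single, update_delete_self]
  have hcard : ∀ x ∈ η v, (delete η (v, x) v).card = (η v).card - 1 := fun x hx => by
    simp [delete, Finset.card_erase_of_mem hx]
  by_cases h : (η v).card = 2
  · obtain ⟨x, y, hxy, hv⟩ := Finset.card_eq_two.1 h
    have hx : x ∈ η v := by simp [hv]
    have hy : y ∈ η v := by simp [hv]
    rw [Finset.filter_true_of_mem fun _ _ => h.ge,
      Finset.sum_congr rfl fun z hz => if_pos (by rw [hcard z hz, h]), hv,
      Finset.sum_pair hxy, ← Finsupp.single_add]
    have h1 := sign_mul_sign_delete (p := (v, x)) (q := (v, y)) hx hy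
      fun h => hxy (Prod.mk.inj h).2
    -- In both families the remaining color is alone at `v`, so no smaller color there affects the
    -- sign. The anticommutation relation `h1` then factors, with one factor `±1`.
    have h2 : sign (delete η (v, x)) (v, y) = sign (delete η (v, y)) (v, x) := by
      refine sign_congr (fun u hu => ?_) ?_
      · rw [delete_apply_of_ne _ hu.ne', delete_apply_of_ne _ hu.ne']
      · simp [delete, hv, Finset.filter_singleton, Finset.erase_insert_of_ne, hxy]
    rw [h2, ← add_mul] at h1
    rcases mul_eq_zero.1 h1 with h1 | h1
    · rw [h1, Finsupp.single_zero]
    · simp [sign] at h1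
  · refine Finset.sum_eq_zero fun x hx => if_neg ?_
    rw [Finset.mem_filter] at hx
    rw [hcard x hx.1]
    omega

theorem proj_boundaryAt_of_card_ne {u v : V} (huv : u ≠ v) {η : V → Finset W}
    (h : (η v).card ≠ 1) : proj v (boundaryAt u η) = 0 := by
  simp only [boundaryAt, map_sum, proj_single, delete_apply_of_ne _ huv, if_neg h,
    Finset.sum_const_zero]

theorem boundaryAt_eq_zero {u : V} {η : V → Finset W} (h : (η u).card < 2) :
    boundaryAt u η = 0 := by
  rw [boundaryAt, Finset.filter_false_of_mem fun _ _ => by omega, Finset.sum_empty]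

/-- Emptying the set at `v` changes no sign at `u < v`, and the empty sets beyond `v` have no faces.
-/
theorem proj_boundary_single {v : V} {η : V → Finset W} (hη : ∀ u, v < u → η u = ∅) :
    proj v (boundary (Finsupp.single η 1)) = boundary (proj v (Finsupp.single η 1)) := by
  rw [boundary_single_one, map_sum, proj_single]
  split_ifs with h
  · rw [boundary_single_one]
    refine Finset.sum_congr rfl fun u _ => ?_
    rcases lt_trichotomy u v with huv | rfl | huv
    · simp only [boundaryAt, map_sum, proj_single, delete_apply_of_ne _ huv.ne, if_pos h,
        Function.update_of_ne huv.ne, delete_update_of_ne _ huv.ne]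
      refine Finset.sum_congr rfl fun x _ => ?_
      congr 1
      refine sign_congr (fun w hw => ?_) ?_
      · rw [Function.update_of_ne (hw.trans huv).ne]
      · rw [Function.update_of_ne huv.ne]
    · rw [proj_boundaryAt_self, boundaryAt_eq_zero (by simp)]
    · rw [boundaryAt_eq_zero (by simp [hη u huv]),
        boundaryAt_eq_zero (by simp [Function.update_of_ne huv.ne', hη u huv]), map_zero]
  · rw [map_zero]
    refine Finset.sum_eq_zero fun u _ => ?_
    by_cases huv : u = v
    · rw [huv, proj_boundaryAt_self]
    · exact proj_boundaryAt_of_card_ne huv h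

theorem proj_boundary {v : V} {z : (V → Finset W) →₀ ℤ}
    (hz : z ∈ Finsupp.supported ℤ ℤ {η | ∀ u, v < u → η u = ∅}) :
    proj v (boundary z) = boundary (proj v z) := by
  rw [Finsupp.supported_eq_span_single] at hz
  induction hz using Submodule.span_induction with
  | mem z hz =>
    obtain ⟨η, hη, rfl⟩ := hz
    exact proj_boundary_single hη
  | zero => simp
  | add x y _ _ hx hy => simp only [map_add, hx, hy]
  | smul a x _ hx => simp only [map_smul, hx]

/-! ### The fiberwise cone homotopy modulo lower weight -/

/-- The number of colors used off `v`. -/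
def weight (v : V) (η : V → Finset W) : ℕ :=
  ∑ u ∈ Finset.univ.erase v, (η u).card

theorem weight_update (v : V) (η : V → Finset W) (s : Finset W) :
    weight v (Function.update η v s) = weight v η :=
  Finset.sum_congr rfl fun u hu => by rw [Function.update_of_ne (Finset.ne_of_mem_erase hu)]

theorem weight_delete_lt {u v : V} (huv : u ≠ v) {η : V → Finset W} {x : W} (hx : x ∈ η u) :
    weight v (delete η (u, x)) < weight v η := by
  refine Finset.sum_lt_sum (fun w _ => ?_) ⟨u, Finset.mem_erase.2 ⟨huv, Finset.mem_univ u⟩, ?_⟩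
  · by_cases hw : w = u
    · subst hw
      simpa [delete] using Finset.card_le_card (Finset.erase_subset x (η w))
    · rw [delete_apply_of_ne _ (Ne.symm hw)]
  · simpa [delete] using Finset.card_erase_lt_of_mem hx

theorem boundary_single_sub_boundaryAt_mem (v : V) (η : V → Finset W) :
    boundary (Finsupp.single η 1) - boundaryAt v η ∈
      Finsupp.supported ℤ ℤ {ξ | weight v ξ < weight v η} := by
  rw [boundary_single_one, ← Finset.add_sum_erase _ _ (Finset.mem_univ v), add_sub_cancel_left]
  refine Submodule.sum_mem _ fun u hu => Submodule.sum_mem _ fun x hx =>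
    Finsupp.single_mem_supported _ _ ?_
  exact weight_delete_lt (Finset.ne_of_mem_erase hu) (Finset.mem_filter.1 hx).1

theorem cone_mem_supported_weight {v : V} (col : (V → Finset W) → W) {k : ℕ}
    {z : (V → Finset W) →₀ ℤ} (hz : z ∈ Finsupp.supported ℤ ℤ {ξ | weight v ξ < k}) :
    cone v col z ∈ Finsupp.supported ℤ ℤ {ξ | weight v ξ < k} := by
  rw [cone, Finsupp.linearCombination_apply]
  refine Submodule.sum_mem _ fun η hη => Submodule.smul_mem _ _ ?_
  split_ifs
  · exact Submodule.zero_mem _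
  · refine Finsupp.single_mem_supported _ _ ?_
    rw [Set.mem_ofPred_eq, weight_update]
    exact hz hη

/-- The cone kills each face that still contains the chosen color, so only the face opposite to it
contributes, and coning restores `η` with sign squared. If the chosen color is alone at `v`, there
is no such face and lifting the projection restores `η`. -/
theorem cone_boundaryAt_add_lift_proj_of_mem {v : V} {col : (V → Finset W) → W}
    (hcol : ∀ η s, col (Function.update η v s) = col η) {η : V → Finset W} (h : col η ∈ η v) :
    cone v col (boundaryAt v η) + lift v col (proj v (Finsupp.single η 1)) =
      Finsupp.single η 1 := by
  have hdel : ∀ x, col (delete η (v, x)) = col η := fun x => hcol η _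
  have hpos := Finset.card_pos.2 ⟨_, h⟩
  rw [proj_single]
  split_ifs with h1
  · rw [boundaryAt_eq_zero (by omega), map_zero, zero_add, lift_single, hcol, Function.update_idem]
    obtain ⟨x, hx⟩ := Finset.card_eq_one.1 h1
    rw [hx, Finset.mem_singleton] at h
    rw [h, ← hx, Function.update_eq_self]
  · rw [map_zero, add_zero, boundaryAt, Finset.filter_true_of_mem fun _ _ => by omega, map_sum,
      Finset.sum_eq_single_of_mem _ h]
    · rw [cone_single, hdel, update_delete_self]
      have : delete η (v, col η) v = (η v).erase (col η) := Function.update_self _ _ _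
      rw [this, if_neg (Finset.notMem_erase _ _), Finset.insert_erase h, Function.update_eq_self,
        sign_congr (η := delete η (v, col η)) (ξ := η) (x := col η) (y := col η), sign_mul_self]
      · exact fun u hu => delete_apply_of_ne _ hu.ne' _
      · rw [this, Finset.filter_erase, Finset.erase_eq_of_notMem (by simp)]
    · intro x _ hx
      rw [cone_single, hdel, if_pos]
      simpa [delete] using ⟨hx.symm, h⟩

/-- The face of the cone opposite the new color is `η`. The other faces cancel against the cones on
the faces of `η`. If `η v` is a single color, the one other face carries only the new color at `v`
and cancels against the lift of the projection. -/
theorem boundaryAt_cone_add_of_notMem {v : V} {col : (V → Finset W) → W}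
    (hcol : ∀ η s, col (Function.update η v s) = col η) {η : V → Finset W} (h : col η ∉ η v)
    (hne : (η v).Nonempty) :
    sign η (v, col η) • boundaryAt v (Function.update η v (insert (col η) (η v))) +
      cone v col (boundaryAt v η) + lift v col (proj v (Finsupp.single η 1)) =
      Finsupp.single η 1 := by
  have hdel : ∀ x, col (delete η (v, x)) = col η := fun x => hcol η _
  have hpos := Finset.card_pos.2 hne
  set c := col η with hc
  set ξ := Function.update η v (insert c (η v)) with hξ
  have hξv : ξ v = insert c (η v) := Function.update_self _ _ _
  have hξu : ∀ u < v, ξ u = η u := fun u hu => Function.update_of_ne hu.ne _ _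
  have hcard : (ξ v).card = (η v).card + 1 := by rw [hξv, Finset.card_insert_of_notMem h]
  have hsign : sign ξ (v, c) = sign η (v, c) := sign_congr hξu <| by
    rw [hξv, Finset.filter_insert, if_neg (lt_irrefl c)]
  have hdelc : delete ξ (v, c) = η := by
    rw [delete]
    simp only [hξv, Finset.erase_insert h]
    rw [hξ, Function.update_idem, Function.update_eq_self]
  have hbd : sign η (v, c) • boundaryAt v ξ = Finsupp.single η 1 +
      ∑ x ∈ η v, Finsupp.single (delete ξ (v, x)) (sign η (v, c) * sign ξ (v, x)) := by
    rw [boundaryAt, Finset.filter_true_of_mem fun _ _ => by omega, hξv, Finset.sum_insert h,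
      smul_add, hdelc, hsign, Finset.smul_sum, Finsupp.smul_single, smul_eq_mul, sign_mul_self]
    simp only [Finsupp.smul_single, smul_eq_mul]
  have hcancel : ∀ x ∈ η v, sign η (v, c) * sign η (v, x) +
      sign ξ (v, x) * sign (delete ξ (v, x)) (v, c) = 0 := fun x hx => by
    have := sign_mul_sign_delete (η := ξ) (p := (v, c)) (q := (v, x)) (by simp [hξv])
      (by simp [hξv, hx]) fun h' => h ((Prod.mk.inj h').2 ▸ hx)
    rwa [hsign, hdelc] at this
  have hdelx : ∀ x ∈ η v, delete ξ (v, x) v = insert c ((η v).erase x) := fun x hx => by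
    rw [delete, Function.update_self, hξv, Finset.erase_insert_of_ne]
    rintro rfl
    exact h hx
  rw [hbd, proj_single]
  split_ifs with h1
  · rw [boundaryAt_eq_zero (by omega), map_zero, add_zero, lift_single, hcol, Function.update_idem]
    obtain ⟨x, hx⟩ := Finset.card_eq_one.1 h1
    have hxm : x ∈ η v := by simp [hx]
    have e : delete ξ (v, x) = Function.update η v {c} := by
      have := hdelx x hxm
      rw [hx, Finset.erase_singleton, insert_empty_eq] at this
      rw [← Function.update_eq_self v (delete ξ (v, x)), this, update_delete_self, hξ,
        Function.update_idem]
    have e2 : sign (delete ξ (v, x)) (v, c) = sign η (v, x) := by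
      rw [e]
      refine sign_congr (fun u hu => Function.update_of_ne hu.ne _ _) ?_
      simp [hx, Finset.filter_singleton]
    have e3 : sign η (v, c) * sign ξ (v, x) = -1 := by
      have h2 := hcancel x hxm
      rw [e2] at h2
      -- Multiply the cancellation relation by the two signs at `x` and replace squares of signs by
      -- `1`.
      linear_combination (sign ξ (v, x) * sign η (v, x)) * h2 -
        (sign η (v, c) * sign ξ (v, x)) * sign_mul_self η (v, x) -
        (sign η (v, x) * sign η (v, x)) * sign_mul_self ξ (v, x) - sign_mul_self η (v, x)
    rw [hx, Finset.sum_singleton, e3, e, add_assoc, ← hc, ← Finsupp.single_add]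
    simp
  · rw [map_zero, add_zero, add_assoc, add_eq_left, boundaryAt,
      Finset.filter_true_of_mem fun _ _ => by omega, map_sum, ← Finset.sum_add_distrib]
    refine Finset.sum_eq_zero fun x hx => ?_
    have e : Function.update η v (insert c ((η v).erase x)) = delete ξ (v, x) := by
      rw [← hdelx x hx, ← Function.update_eq_self v (delete ξ (v, x)), update_delete_self, hξ,
        Function.update_idem]
      simp
    have e1 : delete η (v, x) v = (η v).erase x := Function.update_self _ _ _
    have e2 : sign (delete η (v, x)) (v, c) = sign (delete ξ (v, x)) (v, c) := by
      refine sign_congr (fun u hu => ?_) ?_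
      · rw [delete_apply_of_ne _ hu.ne', delete_apply_of_ne _ hu.ne', hξu u hu]
      · rw [e1, hdelx x hx, Finset.filter_insert, if_neg (lt_irrefl c)]
    rw [cone_single, hdel, e1, if_neg fun h' => h (Finset.mem_of_mem_erase h'), update_delete_self,
      e, e2, ← Finsupp.single_add, Finsupp.single_eq_zero]
    linear_combination (sign η (v, x) * sign ξ (v, x)) * hcancel x hx -
      (sign η (v, c) * sign ξ (v, x)) * sign_mul_self η (v, x) -
      (sign η (v, x) * sign (delete ξ (v, x)) (v, c)) * sign_mul_self ξ (v, x)

/-- Up to cells of smaller weight, `cone` is a contracting homotopy of the fibers of `proj`. -/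
theorem homotopy_mem_supported {v : V} {col : (V → Finset W) → W}
    (hcol : ∀ η s, col (Function.update η v s) = col η) {η : V → Finset W} (hne : (η v).Nonempty) :
    Finsupp.single η 1 - boundary (cone v col (Finsupp.single η 1)) -
      cone v col (boundary (Finsupp.single η 1)) - lift v col (proj v (Finsupp.single η 1)) ∈
      Finsupp.supported ℤ ℤ {ξ | weight v ξ < weight v η} := by
  have h1 := cone_mem_supported_weight col (boundary_single_sub_boundaryAt_mem v η)
  rw [map_sub] at h1
  by_cases h : col η ∈ η v
  · have h2 := cone_boundaryAt_add_lift_proj_of_mem hcol h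
    rw [cone_single, if_pos h, map_zero, sub_zero]
    convert Submodule.neg_mem _ h1 using 1
    nth_rw 1 [← h2]
    abel
  · have h2 := boundaryAt_cone_add_of_notMem hcol h hne
    have h3 := boundary_single_sub_boundaryAt_mem v (Function.update η v (insert (col η) (η v)))
    rw [weight_update] at h3
    have h4 := Submodule.smul_mem _ (sign η (v, col η)) h3
    have h5 : cone v col (Finsupp.single η 1) = sign η (v, col η) •
        Finsupp.single (Function.update η v (insert (col η) (η v))) 1 := by
      rw [cone_single, if_neg h, Finsupp.smul_single, smul_eq_mul, one_mul, mul_one]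
    rw [h5, map_smul]
    convert Submodule.neg_mem _ (Submodule.add_mem _ h1 h4) using 1
    nth_rw 1 [← h2]
    rw [smul_sub]
    abel

theorem map_mem_of_mem_supported {L : ((V → Finset W) →₀ ℤ) →ₗ[ℤ] ((V → Finset W) →₀ ℤ)}
    {S : Set (V → Finset W)} {N : Submodule ℤ ((V → Finset W) →₀ ℤ)}
    (h : ∀ η ∈ S, L (Finsupp.single η 1) ∈ N) {z : (V → Finset W) →₀ ℤ}
    (hz : z ∈ Finsupp.supported ℤ ℤ S) : L z ∈ N := by
  rw [Finsupp.supported_eq_span_single] at hz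
  refine (Submodule.span_le (p := N.comap L)).2 ?_ hz
  rintro _ ⟨η, hη, rfl⟩
  exact h η hη

theorem eqOn_supported {L L' : ((V → Finset W) →₀ ℤ) →ₗ[ℤ] ((V → Finset W) →₀ ℤ)}
    {S : Set (V → Finset W)} (h : ∀ η ∈ S, L (Finsupp.single η 1) = L' (Finsupp.single η 1))
    {z : (V → Finset W) →₀ ℤ} (hz : z ∈ Finsupp.supported ℤ ℤ S) : L z = L' z := by
  have := map_mem_of_mem_supported (L := L - L') (N := ⊥)
    (fun η hη => by simp [h η hη]) hz
  simpa [sub_eq_zero] using this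

/-! ### Free colors and cycles killed by the projection -/

section Vertex

variable (G : SimpleGraph V) [DecidableRel G.Adj] (v : V)

/-- The colors used at the neighbors of `v`. -/
def usedColors (η : V → Finset W) : Finset W :=
  (G.neighborFinset v).biUnion η

variable {G v} {U : Finset V} {t : ℕ}

theorem usedColors_update (η : V → Finset W) (s : Finset W) :
    usedColors G v (Function.update η v s) = usedColors G v η :=
  Finset.biUnion_congr rfl fun u hu =>
    Function.update_of_ne ((G.mem_neighborFinset v u).1 hu).ne' _ _

theorem disjoint_of_notMem_usedColors {η : V → Finset W} {x : W} (h : x ∉ usedColors G v η) (u : V)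
    (hu : G.Adj v u) : Disjoint {x} (η u) := by
  rw [Finset.disjoint_singleton_left]
  exact fun hx => h (Finset.mem_biUnion.2 ⟨u, (G.mem_neighborFinset v u).2 hu, hx⟩)

/-- A color at `v` itself is unused by the neighbors, so coning needs no bound on the number of
colors. -/
theorem usedColors_ne_univ {η : V → Finset W} (hη : η ∈ cells G U t) (hv : v ∈ U) :
    usedColors G v η ≠ Finset.univ := by
  obtain ⟨x, hx⟩ := (hη.1 v).2 hv
  intro h
  obtain ⟨u, hu, hxu⟩ := Finset.mem_biUnion.1 (h.symm ▸ Finset.mem_univ x)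
  exact Finset.disjoint_left.1 (hη.2.1 v u ((G.mem_neighborFinset v u).1 hu)) hx hxu

/-- Each vertex of `U` carries one color plus an excess, and the excesses add up to `t`. -/
theorem card_usedColors_le {η : V → Finset W} (hη : η ∈ cells G U t) :
    (usedColors G v η).card ≤ t + G.degree v := by
  have h0 : ∀ u ∉ U, (η u).card = 0 := fun u hu =>
    Finset.card_eq_zero.2 (Finset.not_nonempty_iff_eq_empty.1 fun h => hu ((hη.1 u).1 h))
  have hsum : ∑ u ∈ U, ((η u).card - 1) = t := by
    have h1 : ∑ u ∈ U, (η u).card = t + U.card := by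
      rw [← hη.2.2]
      exact Finset.sum_subset (Finset.subset_univ U) fun u _ hu => h0 u hu
    have h2 : ∑ u ∈ U, ((η u).card - 1 + 1) = ∑ u ∈ U, (η u).card :=
      Finset.sum_congr rfl fun u hu => Nat.sub_add_cancel (Finset.card_pos.2 ((hη.1 u).2 hu))
    rw [Finset.sum_add_distrib, h1] at h2
    simpa using h2
  calc (usedColors G v η).card
      ≤ ∑ u ∈ G.neighborFinset v, (η u).card := Finset.card_biUnion_le
    _ ≤ ∑ u ∈ G.neighborFinset v, ((η u).card - 1 + 1) :=
        -- Only an inequality: for an empty set, truncated subtraction gives `0 - 1 + 1 = 1`.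
        Finset.sum_le_sum fun u _ => by omega
    _ = ∑ u ∈ G.neighborFinset v, ((η u).card - 1) + G.degree v := by
        rw [Finset.sum_add_distrib]
        simp
    _ ≤ ∑ u, ((η u).card - 1) + G.degree v :=
        Nat.add_le_add_right (Finset.sum_le_sum_of_subset (Finset.subset_univ _)) _
    _ = t + G.degree v := by
        rw [← hsum, Finset.sum_subset (Finset.subset_univ U) fun u _ hu => by simp [h0 u hu]]

theorem proj_mem_supported_cells (hv : v ∉ U) {z : (V → Finset W) →₀ ℤ}
    (hz : z ∈ Finsupp.supported ℤ ℤ (cells G (insert v U) t)) :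
    proj v z ∈ Finsupp.supported ℤ ℤ (cells G U t) := by
  refine map_mem_of_mem_supported (fun η hη => ?_) hz
  rw [proj_single]
  split_ifs with h
  · refine Finsupp.single_mem_supported _ _
      ⟨fun u => ?_, disjoint_update hη.2.1 fun u _ => Finset.disjoint_empty_left _, ?_⟩
    · by_cases hu : u = v
      · simp [hu, hv]
      · rw [Function.update_of_ne hu, hη.1, Finset.mem_insert, or_iff_right hu]
    · have h1 := sum_card_update η v ∅
      have h2 := hη.2.2
      rw [Finset.card_insert_of_notMem hv] at h2
      rw [Finset.card_empty] at h1
      omega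
  · exact Submodule.zero_mem _

variable {col : (V → Finset W) → W}

theorem lift_mem_supported_cells (hv : v ∉ U)
    (hfree : ∀ η ∈ cells G U t, col η ∉ usedColors G v η) {z : (V → Finset W) →₀ ℤ}
    (hz : z ∈ Finsupp.supported ℤ ℤ (cells G U t)) :
    lift v col z ∈ Finsupp.supported ℤ ℤ (cells G (insert v U) t) := by
  refine map_mem_of_mem_supported (fun η hη => ?_) hz
  rw [lift_single]
  refine Finsupp.single_mem_supported _ _
    ⟨fun u => ?_, disjoint_update hη.2.1 (disjoint_of_notMem_usedColors (hfree η hη)), ?_⟩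
  · by_cases hu : u = v
    · simp [hu]
    · rw [Function.update_of_ne hu, hη.1, Finset.mem_insert, or_iff_right hu]
  · have h1 := sum_card_update η v {col η}
    have h2 := hη.2.2
    have h3 : η v = ∅ := Finset.not_nonempty_iff_eq_empty.1 fun h => hv ((hη.1 v).1 h)
    rw [h3, Finset.card_empty, Finset.card_singleton] at h1
    rw [Finset.card_insert_of_notMem hv]
    omega

theorem proj_lift (hv : v ∉ U) {z : (V → Finset W) →₀ ℤ}
    (hz : z ∈ Finsupp.supported ℤ ℤ (cells G U t)) : proj v (lift v col z) = z := by
  refine eqOn_supported (L := proj v ∘ₗ lift v col) (L' := LinearMap.id) (fun η hη => ?_) hz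
  have h : η v = ∅ := Finset.not_nonempty_iff_eq_empty.1 fun h => hv ((hη.1 v).1 h)
  simp [lift_single, proj_single, ← h]

theorem cone_mem_supported_cells (hv : v ∈ U)
    (hfree : ∀ η ∈ cells G U t, col η ∉ usedColors G v η) {z : (V → Finset W) →₀ ℤ}
    (hz : z ∈ Finsupp.supported ℤ ℤ (cells G U t)) :
    cone v col z ∈ Finsupp.supported ℤ ℤ (cells G U (t + 1)) := by
  refine map_mem_of_mem_supported (fun η hη => ?_) hz
  rw [cone_single]
  split_ifs with h
  · exact Submodule.zero_mem _
  · refine Finsupp.single_mem_supported _ _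
      ⟨fun u => ?_, disjoint_update hη.2.1 fun u hu => ?_, ?_⟩
    · by_cases hu : u = v
      · simp [hu, hv]
      · rw [Function.update_of_ne hu, hη.1]
    · rw [Finset.insert_eq, Finset.disjoint_union_left]
      exact ⟨disjoint_of_notMem_usedColors (hfree η hη) u hu, hη.2.1 v u hu⟩
    · have h1 := sum_card_update η v (insert (col η) (η v))
      have h2 := hη.2.2
      rw [Finset.card_insert_of_notMem h] at h1
      omega

theorem proj_cone (hv : v ∈ U) {z : (V → Finset W) →₀ ℤ}
    (hz : z ∈ Finsupp.supported ℤ ℤ (cells G U t)) : proj v (cone v col z) = 0 := by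
  refine eqOn_supported (L := proj v ∘ₗ cone v col) (L' := 0) (fun η hη => ?_) hz
  rw [LinearMap.comp_apply, cone_single]
  split_ifs with h
  · simp
  · have := Finset.card_pos.2 ((hη.1 v).2 hv)
    rw [proj_single, Function.update_self, Finset.card_insert_of_notMem h, if_neg (by omega),
      LinearMap.zero_apply]

theorem exists_boundary_eq_of_proj_eq_zero (hv : v ∈ U) (hmax : ∀ u ∈ U, u ≤ v)
    (hcol : ∀ η s, col (Function.update η v s) = col η)
    (hfree : ∀ η ∈ cells G U t, col η ∉ usedColors G v η) (k : ℕ) :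
    ∀ z : (V → Finset W) →₀ ℤ, z ∈ Finsupp.supported ℤ ℤ (cells G U t) →
      z ∈ Finsupp.supported ℤ ℤ {η | weight v η < k} → boundary z = 0 → proj v z = 0 →
      ∃ y ∈ Finsupp.supported ℤ ℤ (cells G U (t + 1)), boundary y = z := by
  induction k with
  | zero =>
    intro z _ hz _ _
    refine ⟨0, Submodule.zero_mem _, ?_⟩
    simp at hz
    simp [hz]
  | succ k ih =>
    intro z hz hk hb hp
    have hc := cone_mem_supported_cells hv hfree hz
    have hsub : cells G U (t + 1) ⊆ {η : V → Finset W | ∀ u, v < u → η u = ∅} := fun η hη u hu =>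
      Finset.not_nonempty_iff_eq_empty.1 fun h => (hmax u ((hη.1 u).1 h)).not_gt hu
    -- Two terms of the homotopy formula vanish, since both the boundary and the projection of `z`
    -- are zero.
    have hz' : z - boundary (cone v col z) ∈
        Finsupp.supported ℤ ℤ {η : V → Finset W | weight v η < k} := by
      have hzS : z ∈ Finsupp.supported ℤ ℤ (cells G U t ∩ {η | weight v η < k + 1}) := by
        rw [Finsupp.supported_inter]
        exact ⟨hz, hk⟩
      have := map_mem_of_mem_supported (L := LinearMap.id - boundary ∘ₗ cone v col -
        cone v col ∘ₗ boundary - lift v col ∘ₗ proj v)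
        (N := Finsupp.supported ℤ ℤ {η | weight v η < k}) (fun η hη => Finsupp.supported_mono
          (fun ξ hξ => lt_of_lt_of_le hξ (Nat.lt_succ_iff.1 hη.2))
          (homotopy_mem_supported hcol ((hη.1.1 v).2 hv))) hzS
      simpa [hb, hp] using this
    obtain ⟨y, hy, hyz⟩ := ih (z - boundary (cone v col z))
      (Submodule.sub_mem _ hz (boundary_mem_supported hc)) hz'
      (by rw [map_sub, hb, boundary_boundary, sub_zero])
      -- A coned cell has at least two colors at `v`, so the correction stays in the kernel of the
      -- projection.
      (by rw [map_sub, hp, proj_boundary (Finsupp.supported_mono hsub hc), proj_cone hv hz,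
        map_zero, sub_zero])
    exact ⟨y + cone v col z, Submodule.add_mem _ hy hc, by rw [map_add, hyz, sub_add_cancel]⟩

end Vertex

/-! ### Induction over the vertices -/

theorem exists_boundary_eq (G : SimpleGraph V) [DecidableRel G.Adj] {t : ℕ} (h0 : t ≠ 0)
    (ht : t + G.maxDegree + 2 ≤ Fintype.card W) (U : Finset V) :
    ∀ z ∈ Finsupp.supported ℤ ℤ (cells (W := W) G U t), boundary z = 0 →
      ∃ y ∈ Finsupp.supported ℤ ℤ (cells G U (t + 1)), boundary y = z := by
  induction U using Finset.induction_on_max with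
  | empty =>
    intro z hz _
    refine ⟨0, Submodule.zero_mem _, ?_⟩
    -- The empty family has dimension `0`; this is where positive degree is needed.
    have : cells (W := W) G ∅ t = ∅ := by
      refine Set.eq_empty_of_forall_notMem fun η hη => h0 ?_
      have h : ∑ u, (η u).card = 0 := Finset.sum_eq_zero fun u _ => Finset.card_eq_zero.2 <|
        Finset.not_nonempty_iff_eq_empty.1 fun h => Finset.notMem_empty u ((hη.1 u).1 h)
      simpa [h] using hη.2.2.symm
    rw [this] at hz
    simp at hz
    simp [hz]
  | insert v U hlt ih =>
    intro z hz hb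
    have hv : v ∉ U := fun h => lt_irrefl v (hlt v h)
    have hmax : ∀ u ∈ insert v U, u ≤ v := fun u hu => by
      rcases Finset.mem_insert.1 hu with rfl | hu
      exacts [le_rfl, (hlt u hu).le]
    have hW : Nonempty W := Fintype.card_pos_iff.1 (by omega)
    have hc : ∀ A : Finset W, ∃ x, A ≠ Finset.univ → x ∉ A := fun A => by
      by_cases h : A = Finset.univ
      · exact ⟨Classical.arbitrary W, fun h' => (h' h).elim⟩
      · obtain ⟨x, hx⟩ := not_forall.1 fun h' => h (Finset.eq_univ_iff_forall.2 h')
        exact ⟨x, fun _ => hx⟩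
    choose c hc using hc
    -- The choice depends only on the colors at the neighbors, hence not on the set at `v`. It
    -- serves both to lift cells on `U` and to cone cells on `insert v U`.
    set col : (V → Finset W) → W := fun η => c (usedColors G v η)
    have hcol : ∀ η s, col (Function.update η v s) = col η := fun η s =>
      congrArg c (usedColors_update η s)
    have hsub : ∀ s, cells G (insert v U) s ⊆ {η : V → Finset W | ∀ u, v < u → η u = ∅} :=
      fun s η hη u hu => Finset.not_nonempty_iff_eq_empty.1 fun h =>
        (hmax u ((hη.1 u).1 h)).not_gt hu
    obtain ⟨y, hy, hyz⟩ := ih (proj v z) (proj_mem_supported_cells hv hz)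
      (by rw [← proj_boundary (Finsupp.supported_mono (hsub t) hz), hb, map_zero])
    -- The cells of `y` have dimension `t + 1`, so a free color requires `t + 1 + deg v < n`: this
    -- accounts for the `2` in `ht`.
    have hly := lift_mem_supported_cells (col := col) hv (fun η hη => hc _ fun h => by
      have h1 := card_usedColors_le (v := v) hη
      have h2 := G.degree_le_maxDegree v
      rw [h, Finset.card_univ] at h1
      omega) hy
    have hz' : z - boundary (lift v col y) ∈ Finsupp.supported ℤ ℤ (cells G (insert v U) t) :=
      Submodule.sub_mem _ hz (boundary_mem_supported hly)
    obtain ⟨w, hw, hwz⟩ := exists_boundary_eq_of_proj_eq_zero (Finset.mem_insert_self v U) hmax hcol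
      (fun η hη => hc _ (usedColors_ne_univ hη (Finset.mem_insert_self v U)))
      ((z - boundary (lift v col y)).support.sup (weight v) + 1) _ hz'
      (fun η hη => Nat.lt_succ_of_le (Finset.le_sup (f := weight v) hη))
      (by rw [map_sub, hb, boundary_boundary, sub_zero])
      (by rw [map_sub, proj_boundary (Finsupp.supported_mono (hsub _) hly), proj_lift hv hy, hyz,
        sub_self])
    exact ⟨w + lift v col y, Submodule.add_mem _ hw hly, by rw [map_add, hwz, sub_add_cancel]⟩

/-! ### Back to the cellular complex and its homology -/

/-- A cellular chain of `Hom(G, H)` as a chain of set families. -/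
def toFamilies (G : SimpleGraph V) (H : SimpleGraph W) (t : ℕ) :
    (HomCell G H t →₀ ℤ) →ₗ[ℤ] ((V → Finset W) →₀ ℤ) :=
  Finsupp.lmapDomain ℤ ℤ HomCell.toFun

theorem toFamilies_injective (G : SimpleGraph V) (H : SimpleGraph W) (t : ℕ) :
    Function.Injective (toFamilies G H t) :=
  Finsupp.mapDomain_injective fun _ _ => ext_toFun

theorem toFamilies_homBoundary (G : SimpleGraph V) (H : SimpleGraph W) (t : ℕ)
    (z : HomCell G H (t + 1) →₀ ℤ) :
    toFamilies G H t (homBoundary G H t z) = boundary (toFamilies G H (t + 1) z) := by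
  suffices h : toFamilies G H t ∘ₗ homBoundary G H t = boundary ∘ₗ toFamilies G H (t + 1) from
    LinearMap.congr_fun h z
  refine Finsupp.lhom_ext' fun η => LinearMap.ext_ring ?_
  simp only [LinearMap.comp_apply, Finsupp.lsingle_apply, homBoundary, toFamilies,
    Finsupp.linearCombination_single, one_smul, Finsupp.lmapDomain_apply, map_sum,
    Finsupp.mapDomain_single, boundary_single]
  exact (Finset.sum_subtype (removable η.toFun) (fun p => mem_removable)
    fun p => Finsupp.single (delete η.toFun p) (sign η.toFun p)).symm

/-- In a complete graph, two sets of colors are completely joined exactly when they are disjoint. -/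
theorem range_toFamilies (G : SimpleGraph V) (t : ℕ) :
    LinearMap.range (toFamilies G (⊤ : SimpleGraph W) t) =
      Finsupp.supported ℤ ℤ (cells G Finset.univ t) := by
  have hrange : Set.range (HomCell.toFun (G := G) (H := (⊤ : SimpleGraph W)) (t := t)) =
      cells G Finset.univ t := by
    ext η
    constructor
    · rintro ⟨ξ, rfl⟩
      exact ⟨fun u => by simpa using ξ.isHomCell.1 u, fun x y h =>
        Finset.disjoint_left.2 fun a ha hb => (ξ.isHomCell.2 x y h a ha a hb).ne rfl, ξ.dim_eq⟩
    · rintro ⟨h1, h2, h3⟩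
      exact ⟨⟨η, ⟨fun u => (h1 u).2 (Finset.mem_univ u), fun x y h a ha b hb =>
        Finset.disjoint_iff_ne.1 (h2 x y h) a ha b hb⟩, h3⟩, rfl⟩
  rw [toFamilies, Finsupp.range_lmapDomain, Finsupp.supported_eq_span_single, ← hrange, ← Set.range_comp]
  rfl

theorem exists_homBoundary_eq (G : SimpleGraph V) [DecidableRel G.Adj] {t : ℕ}
    (ht : t + 1 + G.maxDegree + 2 ≤ Fintype.card W)
    (z : HomCell G (⊤ : SimpleGraph W) (t + 1) →₀ ℤ) (hz : homBoundary G ⊤ t z = 0) :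
    ∃ y, homBoundary G ⊤ (t + 1) y = z := by
  obtain ⟨y, hy, hyz⟩ := exists_boundary_eq G t.succ_ne_zero ht Finset.univ
    (toFamilies G ⊤ (t + 1) z) (range_toFamilies (W := W) G (t + 1) ▸ LinearMap.mem_range_self _ z)
    (by rw [← toFamilies_homBoundary, hz, map_zero])
  rw [← range_toFamilies] at hy
  obtain ⟨x, rfl⟩ := hy
  exact ⟨x, toFamilies_injective _ _ _ (by rw [toFamilies_homBoundary, hyz])⟩

end HomCell

theorem isZero_homHomology_of_exact {V W : Type*} [Fintype V] [Fintype W] [LinearOrder V]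
    [LinearOrder W] (G : SimpleGraph V) (H : SimpleGraph W) (t : ℕ)
    (h : ∀ z, homBoundary G H t z = 0 → ∃ y, homBoundary G H (t + 1) y = z) :
    Limits.IsZero (homHomology G H (t + 1)) := by
  rw [homHomology, ← HomologicalComplex.exactAt_iff_isZero_homology,
    HomologicalComplex.exactAt_iff' _ (t + 2) (t + 1) t (by simp) (by simp),
    ShortComplex.moduleCat_exact_iff]
  intro z hz
  have hd (s : ℕ) : (homChainComplex G H).d (s + 1) s = ModuleCat.ofHom (homBoundary G H s) :=
    ChainComplex.of_d (fun t => ModuleCat.of ℤ (HomCell G H t →₀ ℤ))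
      (fun t => ModuleCat.ofHom (homBoundary G H t)) s
  change (homChainComplex G H).d (t + 1) t z = 0 at hz
  change ∃ y, (homChainComplex G H).d (t + 2) (t + 1) y = z
  rw [hd] at hz ⊢
  exact h z hz

end

theorem theorem4p2 {V : Type*} [Fintype V] [LinearOrder V] (G : SimpleGraph V)
    [DecidableRel G.Adj] (n : ℕ) (t : ℕ) (h1 : 1 ≤ t) (ht : (t : ℤ) ≤ vgap G n - 1) :
    CategoryTheory.Limits.IsZero (homHomology G (⊤ : SimpleGraph (Fin n)) t) := by
  obtain ⟨t, rfl⟩ := Nat.exists_eq_add_of_le' h1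
  refine isZero_homHomology_of_exact G ⊤ t (HomCell.exists_homBoundary_eq G ?_)
  rw [vgap] at ht
  rw [Fintype.card_fin]
  push_cast at ht
  omega
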